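/- A time series is a finite sequence $x=(x_1,\dots,x_m)$ of real numbers. Fix a constant $c\ge 0$. There are three operations on time series: a move replaces one point $x_i$ by $x_i+w$ ($w\in\mathbb R$) at cost $|w|$; a split replaces one point $x_i$ by two consecutive copies of it at cost $c$; a merge replaces two consecutive points of equal value by one point of that value at cost $c$. A finite sequence $\mathbb S$ of operations that transforms $x$ into $y$ is optimal if its total cost is minimal among all sequences that transform $x$ into $y$. The transformation graph $G_{\mathbb S}(x,y)$ is the directed acyclic graph with source nodes $u_1,\dots,u_m$ of values $\mathrm{val}(u_i)=x_i$, in which each operation of $\mathbb S$ adds, below the nodes representing the current time series, a move edge to a new node, two split edges from one node to two new nodes, or two merge edges from two nodes to one new node; every node has as value the value of the point it represents. The nodes representing the points of the final time series $y$ are the sink nodes $v_1,\dots,v_n$, with $\mathrm{val}(v_j)=y_j$; a node that is neither a source nor a sink is an intermediate node. A move edge is increasing (decreasing) if it adds a positive (negative) value. A directed path is increasing (decreasing) if all its move edges are increasing (decreasing), and monotonic if it is increasing or decreasing. A transformation path is a directed path from a source to a sink. It is of Type 1 if it has only move edges; of Type 2 if it has only split and move edges, at least one of them a split edge; of Type 3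 if it has only merge and move edges, at least one of them a merge edge; of Type 4 if it consists of (possibly no) merge and move edges, then a merge edge, a move edge, a split edge, and then (possibly no) split and move edges. A weakly connected component of the graph that is a tree is a tree of Type 1 if it has one source and one sink and only paths of Type 1; of Type 2 if it has one source, at least two sinks, only paths of Type 2, and all its nodes have indegree at most $1$; of Type 3 if it has at least two sources, one sink, only paths of Type 3, and all its nodes have outdegree at most $1$; of Type 4, with first bottleneck node $\sigma$ and second bottleneck node $\sigma^*$, if it has at least two sources and at least two sinks, all its transformation paths are of Type 4 with $\sigma\to\sigma^*$ as the move edge between the merge edge and the split edge, all nodes above and including $\sigma$ have outdegree $1$, and all nodes below and including $\sigma^*$ have indegree $1$. The graph $G=G_{\mathbb S}(x,y)$ is an optimal transformation forest if $\mathbb S$ is optimal, $G$ has no consecutive merge-split, split-merge or split-move-merge edges, all transformation paths of $G$ are monotonic and of Type 1, 2, 3 or 4, and every weakly connected component of $G$ is a tree of Type 1, 2, 3 or 4. For an intermediate node $\delta$ with two parents, each connected to it by a merge edge, the subtree $\mathcal S(\delta)$ consists of all source nodes that have a directed path to $\delta$ and of all nodes and edges on these paths; it is increasing (decreasing) if all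 directed paths from sources to $\delta$ are increasing (decreasing). Statement. Let $G_{\mathbb S}(x,y)$ be an optimal transformation forest. (a) Let $\delta$ be an intermediate node with two parents, each connected to it by a merge edge. If $\mathcal S(\delta)$ is increasing, then $\mathrm{val}(\delta)=\max\{x_i : u_i\in\mathcal S(\delta)\}$. If $\mathcal S(\delta)$ is decreasing, then $\mathrm{val}(\delta)=\min\{x_i : u_i\in\mathcal S(\delta)\}$. (b) For every tree $\mathcal T$ of Type 4 in $G_{\mathbb S}(x,y)$ with first and second bottleneck nodes $\sigma$ and $\sigma^*$, $\mathrm{val}(\sigma)\in\{x_i : u_i\in\mathcal T\}$ and $\mathrm{val}(\sigma^*)\in\{y_j : v_j\in\mathcal T\}$. -/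

import Mathlib

/-! Move-split-merge transformations of time series and their transformation graphs.
A time series is a `List ℝ`; positions are counted from `0`. -/

namespace MSM

/-- The transformation operations `move_{i,w}`, `split_i`, `merge_i`. -/
inductive Op
  | move (i : ℕ) (w : ℝ)
  | split (i : ℕ)
  | merge (i : ℕ)

/-- The effect of an operation on a time series; `none` if it is not applicable, that is, if the
position does not exist or if a merge is attempted at two different values. -/
noncomputable def Op.apply : Op → List ℝ → Option (List ℝ)
  | .move i w, x =>
    match x.drop i with
    | a :: r => some (x.take i ++ (a + w) :: r)
    | [] => none
  | .split i, x =>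
    match x.drop i with
    | a :: r => some (x.take i ++ a :: a :: r)
    | [] => none
  | .merge i, x =>
    match x.drop i with
    | a :: b :: r => if a = b then some (x.take i ++ a :: r) else none
    | _ => none

/-- A move by `w` costs `|w|`; a split and a merge cost `c`. -/
def Op.cost (c : ℝ) : Op → ℝ
  | .move _ w => |w|
  | .split _ => c
  | .merge _ => c

/-- `T(x, S)`. -/
noncomputable def transform : List ℝ → List Op → Option (List ℝ)
  | x, [] => some x
  | x, s :: S => (s.apply x).bind fun x' => transform x' S

/-- The cost of a sequence of operations. -/
def cost (c : ℝ) (S : List Op) : ℝ := (S.map (Op.cost c)).sum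

/-- `S` transforms `x` into `y`, at the least possible cost. -/
def IsOptimal (c : ℝ) (x y : List ℝ) (S : List Op) : Prop :=
  transform x S = some y ∧ ∀ S', transform x S' = some y → cost c S ≤ cost c S'

inductive EdgeKind
  | move
  | split
  | merge

/-- A labelled directed edge between nodes, which are numbered by natural numbers. -/
structure Edge where
  kind : EdgeKind
  parent : ℕ
  child : ℕ

/-- A transformation graph: its nodes are `0, …, numNodes - 1`, the first `numSources` of which
are the source nodes `u_1, …, u_m`; `sinks` lists the sink nodes `v_1, …, v_n`. -/
structure Graph where
  numNodes : ℕ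
  numSources : ℕ
  val : ℕ → ℝ
  edges : List Edge
  sinks : List ℕ

/-- The graph of the empty sequence of operations: every node is both a source and a sink. -/
def Graph.init (x : List ℝ) : Graph where
  numNodes := x.length
  numSources := x.length
  val := fun k => x.getD k 0
  edges := []
  sinks := List.range x.length

/-- Add new nodes and one move edge, two split edges or two merge edges below the current
last row of nodes. -/
noncomputable def Graph.addOp (G : Graph) : Op → Graph
  | .move i w =>
    match G.sinks.drop i with
    | a :: r =>
      { G with
        numNodes := G.numNodes + 1
        val := Function.update G.val G.numNodes (G.val a + w)
        edges := ⟨.move, a, G.numNodes⟩ :: G.edges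
        sinks := G.sinks.take i ++ G.numNodes :: r }
    | [] => G
  | .split i =>
    match G.sinks.drop i with
    | a :: r =>
      { G with
        numNodes := G.numNodes + 2
        val := Function.update (Function.update G.val G.numNodes (G.val a))
          (G.numNodes + 1) (G.val a)
        edges := ⟨.split, a, G.numNodes⟩ :: ⟨.split, a, G.numNodes + 1⟩ :: G.edges
        sinks := G.sinks.take i ++ G.numNodes :: (G.numNodes + 1) :: r }
    | [] => G
  | .merge i =>
    match G.sinks.drop i with
    | a :: b :: r =>
      { G with
        numNodes := G.numNodes + 1
        val := Function.update G.val G.numNodes (G.val a)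
        edges := ⟨.merge, a, G.numNodes⟩ :: ⟨.merge, b, G.numNodes⟩ :: G.edges
        sinks := G.sinks.take i ++ G.numNodes :: r }
    | _ => G

/-- The transformation graph `G_S(x, y)`, where `y = T(x, S)`. -/
noncomputable def graph (x : List ℝ) (S : List Op) : Graph :=
  S.foldl Graph.addOp (Graph.init x)

namespace Graph

variable (G : Graph)

def IsSource (a : ℕ) : Prop := a < G.numSources

def IsSink (a : ℕ) : Prop := a ∈ G.sinks

def IsIntermediate (a : ℕ) : Prop := a < G.numNodes ∧ ¬ G.IsSource a ∧ ¬ G.IsSink a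

/-- `G.Walk a b p`: the list of edges `p` is a directed path from `a` to `b`. -/
inductive Walk : ℕ → ℕ → List Edge → Prop
  | nil (a : ℕ) : a < G.numNodes → Walk a a []
  | cons (e : Edge) (b : ℕ) (p : List Edge) :
      e ∈ G.edges → Walk e.child b p → Walk e.parent b (e :: p)

/-- All move edges of the path add a positive value. -/
def Increasing (p : List Edge) : Prop :=
  ∀ e ∈ p, e.kind = .move → G.val e.parent < G.val e.child

/-- All move edges of the path add a negative value. -/
def Decreasing (p : List Edge) : Prop :=
  ∀ e ∈ p, e.kind = .move → G.val e.child < G.val e.parent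

/-- A transformation path: a directed path from a source node to a sink node. -/
def IsTransformationPath (u v : ℕ) (p : List Edge) : Prop :=
  G.IsSource u ∧ G.IsSink v ∧ G.Walk u v p

def IsMonotonic : Prop :=
  ∀ u v p, G.IsTransformationPath u v p → G.Increasing p ∨ G.Decreasing p

end Graph

def IsType1 (p : List Edge) : Prop := ∀ e ∈ p, e.kind = .move

def IsType2 (p : List Edge) : Prop :=
  (∀ e ∈ p, e.kind = .split ∨ e.kind = .move) ∧ ∃ e ∈ p, e.kind = .split

def IsType3 (p : List Edge) : Prop :=
  (∀ e ∈ p, e.kind = .merge ∨ e.kind = .move) ∧ ∃ e ∈ p, e.kind = .merge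

/-- The path consists of merge and move edges (possibly none), then a merge edge, then the move
edge `b`, then a split edge, then split and move edges (possibly none). -/
def IsType4Through (b : Edge) (p : List Edge) : Prop :=
  ∃ (A : List Edge) (e f : Edge) (B : List Edge), p = A ++ e :: b :: f :: B ∧
    (∀ g ∈ A, g.kind = .merge ∨ g.kind = .move) ∧
    e.kind = .merge ∧ b.kind = .move ∧ f.kind = .split ∧
    (∀ g ∈ B, g.kind = .split ∨ g.kind = .move)

def IsType4 (p : List Edge) : Prop := ∃ b, IsType4Through b p

namespace Graph

variable (G : Graph)

/-- The underlying undirected graph (numbers that are not nodes are isolated). -/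
def underlying : SimpleGraph ℕ :=
  SimpleGraph.fromRel fun a b => ∃ e ∈ G.edges, e.parent = a ∧ e.child = b

/-- `T` is the node set of a weakly connected component which is a tree. -/
def IsTreeComponent (T : Set ℕ) : Prop :=
  (∃ a < G.numNodes, T = {b | G.underlying.Reachable a b}) ∧ (G.underlying.induce T).IsTree

def sourcesIn (T : Set ℕ) : Set ℕ := {u | u ∈ T ∧ G.IsSource u}

def sinksIn (T : Set ℕ) : Set ℕ := {v | v ∈ T ∧ G.IsSink v}

def IsTypeOneTree (T : Set ℕ) : Prop :=
  G.IsTreeComponent T ∧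
  (∃! u, u ∈ G.sourcesIn T) ∧ (∃! v, v ∈ G.sinksIn T) ∧
  ∀ u ∈ T, ∀ v p, G.IsTransformationPath u v p → IsType1 p

def IsTypeTwoTree (T : Set ℕ) : Prop :=
  G.IsTreeComponent T ∧
  (∃! u, u ∈ G.sourcesIn T) ∧ (G.sinksIn T).Nontrivial ∧
  (∀ u ∈ T, ∀ v p, G.IsTransformationPath u v p → IsType2 p) ∧
  ∀ e ∈ G.edges, ∀ f ∈ G.edges, e.child ∈ T → e.child = f.child → e = f

def IsTypeThreeTree (T : Set ℕ) : Prop :=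
  G.IsTreeComponent T ∧
  (G.sourcesIn T).Nontrivial ∧ (∃! v, v ∈ G.sinksIn T) ∧
  (∀ u ∈ T, ∀ v p, G.IsTransformationPath u v p → IsType3 p) ∧
  ∀ e ∈ G.edges, ∀ f ∈ G.edges, e.parent ∈ T → e.parent = f.parent → e = f

/-- `T` is a tree of Type 4 with first bottleneck node `σ` and second bottleneck node `σ'`: it has
at least two sources and two sinks, all its paths are of Type 4 through the one bottleneck move
edge from `σ` to `σ'`, the nodes above and including `σ` have outdegree `1`, and the nodes below
and including `σ'` have indegree `1`. -/
def IsTypeFourTree (T : Set ℕ) (σ σ' : ℕ) : Prop :=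
  G.IsTreeComponent T ∧
  (G.sourcesIn T).Nontrivial ∧ (G.sinksIn T).Nontrivial ∧
  (∀ u ∈ T, ∀ v p, G.IsTransformationPath u v p → IsType4Through ⟨.move, σ, σ'⟩ p) ∧
  (∀ a p, G.Walk a σ p → ∃! e, e ∈ G.edges ∧ e.parent = a) ∧
  (∀ b p, G.Walk σ' b p → ∃! e, e ∈ G.edges ∧ e.child = b)

/-- `δ` is an intermediate node with two parents, each connected to it by a merge edge. -/
def IsMergeNode (δ : ℕ) : Prop :=
  G.IsIntermediate δ ∧
  ∃ α β, α ≠ β ∧ (⟨.merge, α, δ⟩ : Edge) ∈ G.edges ∧ (⟨.merge, β, δ⟩ : Edge) ∈ G.edges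

/-- The source nodes of the subtree of `δ`: the source nodes that have a path to `δ`. -/
def subtreeSources (δ : ℕ) : Set ℕ := {u | G.IsSource u ∧ ∃ p, G.Walk u δ p}

def IncreasingSubtree (δ : ℕ) : Prop :=
  ∀ u p, G.IsSource u → G.Walk u δ p → G.Increasing p

def DecreasingSubtree (δ : ℕ) : Prop :=
  ∀ u p, G.IsSource u → G.Walk u δ p → G.Decreasing p

/-- The values `x_i` of the source nodes `u_i` that lie in `T`. -/
def sourceValues (x : List ℝ) (T : Set ℕ) : Set ℝ :=
  {r | ∃ i, G.IsSource i ∧ i ∈ T ∧ x[i]? = some r}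

/-- The values `y_j` of the sink nodes `v_j` that lie in `T`. -/
def sinkValues (y : List ℝ) (T : Set ℕ) : Set ℝ :=
  {r | ∃ j v : ℕ, G.sinks[j]? = some v ∧ v ∈ T ∧ y[j]? = some r}

end Graph

/-- `S` is an optimal sequence of operations from `x` to `y` whose transformation graph is an
optimal transformation forest. -/
structure IsOptimalForest (c : ℝ) (x y : List ℝ) (S : List Op) : Prop where
  optimal : IsOptimal c x y S
  no_merge_split : ∀ e ∈ (graph x S).edges, ∀ f ∈ (graph x S).edges, e.child = f.parent →
    ¬ (e.kind = .merge ∧ f.kind = .split) ∧ ¬ (e.kind = .split ∧ f.kind = .merge)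
  no_split_move_merge : ∀ e ∈ (graph x S).edges, ∀ f ∈ (graph x S).edges,
    ∀ g ∈ (graph x S).edges, e.child = f.parent → f.child = g.parent →
    ¬ (e.kind = .split ∧ f.kind = .move ∧ g.kind = .merge)
  monotonic : (graph x S).IsMonotonic
  paths : ∀ u v p, (graph x S).IsTransformationPath u v p →
    IsType1 p ∨ IsType2 p ∨ IsType3 p ∨ IsType4 p
  components : ∀ a < (graph x S).numNodes, ∃ T : Set ℕ, a ∈ T ∧
    ((graph x S).IsTypeOneTree T ∨ (graph x S).IsTypeTwoTree T ∨ (graph x S).IsTypeThreeTree T ∨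
      ∃ σ σ', (graph x S).IsTypeFourTree T σ σ')

end MSM

/-! The proof is an exchange argument. Let all paths from sources to a merge node `δ` go in one
direction `s = ±1`, and suppose that no source above `δ` has the value of `δ`. The nodes from which
merges alone lead to `δ` all carry this value, so none of them is a source; none comes from a split
either, so each is the child of a move or of merges. Stop every move into this set `ε` too early and
move on by `ε` after the merge at `δ`. At least two moves get shorter by `ε` and only one move of
length `ε` is added, which contradicts optimality (`exists_source_val_eq`). Values are monotone
along directed paths, so the value found is extremal.

Below the second bottleneck node the argument is mirrored. Prolong the bottleneck move by `ε`; the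
splits copy the shift, and at least two later moves get shorter by `ε`, unless some sink already has
the bottleneck value (`exists_sink_val_eq`). The first bottleneck node is a merge node, and the sign
of the bottleneck move fixes the direction of all paths through it.

`exists_shifted_transform` replaces counting the shortened moves by a potential `Φ` on the
successive graphs: each operation is compared with its imitation separately, and the surplus of `ε`
appears as the total change of `Φ`. -/

namespace MSM

/-! ### Invariants of transformation graphs -/

/-- An applicable operation `s` leads from the graph `H` to the graph in the second argument. -/
inductive Graph.Step (H : Graph) : Op → Graph → Prop
  | move (l : List ℕ) (a : ℕ) (r : List ℕ) (w : ℝ) : H.sinks = l ++ a :: r →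
      Step H (.move l.length w)
        { H with
          numNodes := H.numNodes + 1
          val := Function.update H.val H.numNodes (H.val a + w)
          edges := ⟨.move, a, H.numNodes⟩ :: H.edges
          sinks := l ++ H.numNodes :: r }
  | split (l : List ℕ) (a : ℕ) (r : List ℕ) : H.sinks = l ++ a :: r →
      Step H (.split l.length)
        { H with
          numNodes := H.numNodes + 2
          val := Function.update (Function.update H.val H.numNodes (H.val a))
            (H.numNodes + 1) (H.val a)
          edges := ⟨.split, a, H.numNodes⟩ :: ⟨.split, a, H.numNodes + 1⟩ :: H.edges
          sinks := l ++ H.numNodes :: (H.numNodes + 1) :: r }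
  | merge (l : List ℕ) (a b : ℕ) (r : List ℕ) : H.sinks = l ++ a :: b :: r →
      H.val a = H.val b →
      Step H (.merge l.length)
        { H with
          numNodes := H.numNodes + 1
          val := Function.update H.val H.numNodes (H.val a)
          edges := ⟨.merge, a, H.numNodes⟩ :: ⟨.merge, b, H.numNodes⟩ :: H.edges
          sinks := l ++ H.numNodes :: r }

/-- The structural properties shared by all transformation graphs with sources `x`. -/
structure Graph.WF (x : List ℝ) (H : Graph) : Prop where
  numSources : H.numSources = x.length
  le : H.numSources ≤ H.numNodes
  source_val : ∀ i < x.length, x[i]? = some (H.val i)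
  lt : ∀ e ∈ H.edges, e.parent < e.child ∧ e.child < H.numNodes ∧ H.numSources ≤ e.child
  sinks_lt : ∀ a ∈ H.sinks, a < H.numNodes
  sinks_nodup : H.sinks.Nodup
  parent_not_sink : ∀ e ∈ H.edges, e.parent ∉ H.sinks
  sink_or_parent : ∀ a < H.numNodes, a ∈ H.sinks ∨ ∃ e ∈ H.edges, e.parent = a
  source_or_child : ∀ a < H.numNodes, a < H.numSources ∨ ∃ e ∈ H.edges, e.child = a
  same_parent : ∀ e ∈ H.edges, ∀ f ∈ H.edges, e.parent = f.parent →
    e.kind = f.kind ∧ (e.kind = .merge → e.child = f.child)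
  same_child : ∀ e ∈ H.edges, ∀ f ∈ H.edges, e.child = f.child →
    e.kind = f.kind ∧ (e.kind ≠ .merge → e.parent = f.parent)
  val_eq : ∀ e ∈ H.edges, e.kind ≠ .move → H.val e.parent = H.val e.child

theorem Graph.WF.init (x : List ℝ) : (Graph.init x).WF x where
  numSources := rfl
  le := le_rfl
  source_val i hi := by simp [Graph.init, hi]
  lt := by simp [Graph.init]
  sinks_lt := by simp [Graph.init]
  sinks_nodup := by simpa [Graph.init] using List.nodup_range
  parent_not_sink := by simp [Graph.init]
  sink_or_parent := by simp [Graph.init]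
  source_or_child := by simp [Graph.init]
  same_parent := by simp [Graph.init]
  same_child := by simp [Graph.init]
  val_eq := by simp [Graph.init]

theorem Graph.Step.numNodes_lt {H H' : Graph} {s : Op} (h : H.Step s H') :
    H.numNodes < H'.numNodes := by
  cases h <;> simp

theorem Graph.Step.edges_subset {H H' : Graph} {s : Op} (h : H.Step s H') :
    H.edges ⊆ H'.edges := by
  cases h <;> intro e he <;> simp [he]

theorem Graph.Step.val_eq {H H' : Graph} {s : Op} (h : H.Step s H') (a : ℕ)
    (ha : a < H.numNodes) : H'.val a = H.val a := by
  have h1 : a ≠ H.numNodes := ha.ne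
  have h2 : a ≠ H.numNodes + 1 := by omega
  cases h <;> simp [h1, h2]

/-- New edges start at nodes that are just leaving the last row and end at fresh numbers. Hence no
old edge shares a parent or a child with a new one. -/
theorem Graph.WF.step {x : List ℝ} {H H' : Graph} {s : Op} (hH : H.WF x) (h : H.Step s H') :
    H'.WF x := by
  obtain ⟨h1, h2, h3, h4, h5, h6, h7, h8, h9, h10, h11, h12⟩ := hH
  have hv := h.val_eq
  cases h with
  | move l a r w hs =>
    simp only at hv
    constructor <;> simp only [hs, List.mem_cons, List.mem_append, List.nodup_append,
      List.nodup_cons, or_and_right, exists_or, exists_eq_left, forall_eq_or_imp] at *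
    case source_or_child =>
      intro b hb
      by_cases hlt : b < H.numNodes
      · have := h9 b hlt
        tauto
      · have : H.numNodes = b := by omega
        tauto
    all_goals grind
  | split l a r hs =>
    simp only at hv
    constructor <;> simp only [hs, List.mem_cons, List.mem_append, List.nodup_append,
      List.nodup_cons, or_and_right, exists_or, exists_eq_left, forall_eq_or_imp] at *
    case source_or_child =>
      intro b hb
      by_cases hlt : b < H.numNodes
      · have := h9 b hlt
        tauto
      · have : H.numNodes = b ∨ H.numNodes + 1 = b := by omega
        tauto
    all_goals grind
  | merge l a b r hs hab =>
    simp only at hv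
    constructor <;> simp only [hs, List.mem_cons, List.mem_append, List.nodup_append,
      List.nodup_cons, or_and_right, exists_or, exists_eq_left, forall_eq_or_imp] at *
    case source_or_child =>
      intro b hb
      by_cases hlt : b < H.numNodes
      · have := h9 b hlt
        tauto
      · have : H.numNodes = b := by omega
        tauto
    all_goals grind

/-- This ties the graph to the time series: the values of the last row are the current series.
`addOp` does not compare values at a merge; their equality comes from the applicability of `s`. -/
theorem Graph.WF.step_of_apply {x z : List ℝ} {H : Graph} {s : Op} (hH : H.WF x)
    (h : s.apply (H.sinks.map H.val) = some z) :
    H.Step s (H.addOp s) ∧ (H.addOp s).sinks.map (H.addOp s).val = z := by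
  have key : ∀ l : List ℕ, (∀ a ∈ l, a ∈ H.sinks) → ∀ f : ℕ → ℝ,
      (∀ a < H.numNodes, f a = H.val a) → l.map f = l.map H.val := fun l hl f hf =>
    List.map_congr_left fun a ha => hf a (hH.sinks_lt a (hl a ha))
  have decomp : ∀ i a r, H.sinks.drop i = a :: r →
      H.sinks = H.sinks.take i ++ a :: r ∧ (H.sinks.take i).length = i := by
    intro i a r h
    refine ⟨by rw [← h, List.take_append_drop], ?_⟩
    have : (H.sinks.drop i).length = r.length + 1 := by simp [h]
    simp at this ⊢
    omega
  cases s with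
  | move i w =>
    simp only [Op.apply, ← List.map_drop, ← List.map_take] at h
    rcases hd : H.sinks.drop i with _ | ⟨a, r⟩
    · simp [hd] at h
    · obtain ⟨h1, h2⟩ := decomp i a r hd
      have hst := Graph.Step.move (H := H) _ a r w h1
      rw [h2] at hst
      have hv := hst.val_eq
      simp only [hd, List.map_cons, Option.some.injEq] at h
      simp only [Graph.addOp, hd]
      refine ⟨hst, ?_⟩
      rw [List.map_append, List.map_cons, key _ (by grind) _ hv, key r (by grind) _ hv, ← h]
      simp
  | split i =>
    simp only [Op.apply, ← List.map_drop, ← List.map_take] at h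
    rcases hd : H.sinks.drop i with _ | ⟨a, r⟩
    · simp [hd] at h
    · obtain ⟨h1, h2⟩ := decomp i a r hd
      have hst := Graph.Step.split (H := H) _ a r h1
      rw [h2] at hst
      have hv := hst.val_eq
      simp only [hd, List.map_cons, Option.some.injEq] at h
      simp only [Graph.addOp, hd]
      refine ⟨hst, ?_⟩
      rw [List.map_append, List.map_cons, List.map_cons, key _ (by grind) _ hv,
        key r (by grind) _ hv, ← h]
      simp
  | merge i =>
    simp only [Op.apply, ← List.map_drop, ← List.map_take] at h
    rcases hd : H.sinks.drop i with _ | ⟨a, _ | ⟨b, r⟩⟩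
    · simp [hd] at h
    · simp [hd] at h
    · obtain ⟨h1, h2⟩ := decomp i a _ hd
      simp only [hd, List.map_cons, Option.ite_none_right_eq_some, Option.some.injEq] at h
      have hst := Graph.Step.merge (H := H) _ a b r h1 h.1
      rw [h2] at hst
      have hv := hst.val_eq
      simp only [Graph.addOp, hd]
      refine ⟨hst, ?_⟩
      rw [List.map_append, List.map_cons, key _ (by grind) _ hv,
        key r (by grind) _ hv, ← h.2]
      simp

/-! ### Imitating a sequence of operations with shifted values -/

theorem transform_append (x : List ℝ) (S S' : List Op) :
    transform x (S ++ S') = (transform x S).bind fun z => transform z S' := by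
  induction S generalizing x with
  | nil => simp [transform]
  | cons s S ih => cases h : s.apply x <;> simp [transform, h, ih]

theorem cost_append (c : ℝ) (S S' : List Op) : cost c (S ++ S') = cost c S + cost c S' := by
  simp [cost]

theorem graph_append_singleton (x : List ℝ) (S : List Op) (s : Op) :
    graph x (S ++ [s]) = (graph x S).addOp s := by
  simp [graph]

theorem graph_wf {x y : List ℝ} {S : List Op} (h : transform x S = some y) :
    (graph x S).WF x ∧ (graph x S).sinks.map (graph x S).val = y := by
  induction S using List.reverseRecOn generalizing y with
  | nil =>
    refine ⟨.init x, ?_⟩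
    have : x = y := by simpa [transform] using h
    subst this
    apply List.ext_getElem <;> simp +contextual [graph, Graph.init]
  | append_singleton S s ih =>
    rw [transform_append] at h
    rcases hz : transform x S with _ | z
    · simp [hz] at h
    · obtain ⟨h1, h2⟩ := ih hz
      have hs : s.apply ((graph x S).sinks.map (graph x S).val) = some y := by
        simpa [hz, transform, h2] using h
      rw [graph_append_singleton]
      obtain ⟨h3, h4⟩ := h1.step_of_apply hs
      exact ⟨h1.step h3, h4⟩

/-- If every step of `S` can be imitated after shifting the values of the nodes by `φ`, at a cost
that exceeds the original one at most by the increase of a potential `Φ`, then so can `S`. -/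
theorem exists_shifted_transform {c : ℝ} {x y : List ℝ} {S : List Op}
    (h : transform x S = some y) (φ : ℕ → ℝ) (Φ : Graph → ℝ) (hφ : ∀ i < x.length, φ i = 0)
    (hstep : ∀ (H : Graph) (s : Op) (H' : Graph), H.WF x → H.Step s H' →
      H'.edges ⊆ (graph x S).edges → (∀ a < H'.numNodes, H'.val a = (graph x S).val a) →
      ∃ R, transform (H.sinks.map fun a => (graph x S).val a + φ a) R =
          some (H'.sinks.map fun a => (graph x S).val a + φ a) ∧
        cost c R ≤ s.cost c + Φ H' - Φ H) :
    ∃ S', transform x S' = some ((graph x S).sinks.map fun a => (graph x S).val a + φ a) ∧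
      cost c S' ≤ cost c S + Φ (graph x S) - Φ (Graph.init x) := by
  generalize hG : graph x S = G at hstep ⊢
  -- The final graph `G` stays fixed while the prefix `P` grows. Values of existing nodes never
  -- change, so the shift by `φ` can refer to `G` at every stage.
  have main : ∀ P z, transform x P = some z → (graph x P).edges ⊆ G.edges →
      (∀ a < (graph x P).numNodes, (graph x P).val a = G.val a) →
      ∃ S', transform x S' = some ((graph x P).sinks.map fun a => G.val a + φ a) ∧
        cost c S' ≤ cost c P + Φ (graph x P) - Φ (Graph.init x) := by
    intro P
    induction P using List.reverseRecOn with
    | nil =>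
      intro z _ _ hv
      refine ⟨[], ?_, by simp [cost, graph]⟩
      simp only [transform, Option.some.injEq]
      apply List.ext_getElem
      · simp [graph, Graph.init]
      · intro i h1 h2
        have := hv i (by simpa [graph, Graph.init] using h1)
        simp [graph, Graph.init, ← this, hφ i h1, h1]
    | append_singleton P s ih =>
      intro z hz he hv
      rw [transform_append] at hz
      rcases hu : transform x P with _ | u
      · simp [hu] at hz
      obtain ⟨h1, h2⟩ := graph_wf hu
      have hs : s.apply ((graph x P).sinks.map (graph x P).val) = some z := by
        simpa [hu, transform, h2] using hz
      rw [graph_append_singleton] at he hv ⊢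
      have h3 := (h1.step_of_apply hs).1
      obtain ⟨S', hS', hc⟩ := ih u hu (fun e h => he (h3.edges_subset h)) fun a ha => by
        rw [← hv a (ha.trans h3.numNodes_lt), h3.val_eq a ha]
      obtain ⟨R, hR, hcR⟩ := hstep _ s _ h1 h3 he hv
      refine ⟨S' ++ R, by simp [transform_append, hS', hR], ?_⟩
      rw [cost_append, cost_append]
      have : cost c [s] = s.cost c := by simp [cost]
      linarith
  subst hG
  exact main S y h (List.Subset.refl _) fun _ _ => rfl

end MSM

namespace MSM

/-! ### Elementary operations on a row of nodes -/

theorem transform_move {f : ℕ → ℝ} (l r : List ℕ) {a n : ℕ} {w : ℝ} (h : f n = f a + w) :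
    transform ((l ++ a :: r).map f) [.move l.length w] = some ((l ++ n :: r).map f) := by
  simp [transform, Op.apply, h]

theorem transform_split {f : ℕ → ℝ} (l r : List ℕ) {a n m : ℕ} (hn : f n = f a)
    (hm : f m = f a) :
    transform ((l ++ a :: r).map f) [.split l.length] = some ((l ++ n :: m :: r).map f) := by
  simp [transform, Op.apply, hn, hm]

theorem transform_merge {f : ℕ → ℝ} (l r : List ℕ) {a b n : ℕ} (hb : f b = f a)
    (hn : f n = f a) :
    transform ((l ++ a :: b :: r).map f) [.merge l.length] = some ((l ++ n :: r).map f) := by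
  simp [transform, Op.apply, hn, hb]

theorem transform_merge_move {f : ℕ → ℝ} (l r : List ℕ) {a b n : ℕ} {w : ℝ} (hb : f b = f a)
    (hn : f n = f a + w) :
    transform ((l ++ a :: b :: r).map f) [.merge l.length, .move l.length w] =
      some ((l ++ n :: r).map f) := by
  simp [transform, Op.apply, hn, hb]

/-- Supplies the shift `ε`: small enough that no move in the right direction is overshot when it is
shortened. -/
theorem exists_pos_le_of_pos {α : Type*} (f : α → ℝ) (l : List α) :
    ∃ ε > 0, ∀ e ∈ l, 0 < f e → ε ≤ f e := by
  induction l with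
  | nil => exact ⟨1, one_pos, by simp⟩
  | cons a l ih =>
    obtain ⟨ε, hε, h⟩ := ih
    by_cases ha : 0 < f a
    · refine ⟨min ε (f a), lt_min hε ha, fun e he hpos => ?_⟩
      rcases List.mem_cons.1 he with rfl | he
      · exact min_le_right _ _
      · exact (min_le_left _ _).trans (h e he hpos)
    · refine ⟨ε, hε, fun e he hpos => ?_⟩
      rcases List.mem_cons.1 he with rfl | he
      · exact absurd hpos ha
      · exact h e he hpos

/-! ### Walks and directed paths -/

namespace Graph

variable {G : Graph} {x : List ℝ}

theorem Walk.le (hG : G.WF x) {a b : ℕ} {p : List Edge} (h : G.Walk a b p) :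
    a ≤ b ∧ b < G.numNodes := by
  induction h with
  | nil a ha => exact ⟨le_rfl, ha⟩
  | cons e b p he _ ih => exact ⟨((hG.lt e he).1.trans_le ih.1).le, ih.2⟩

theorem Walk.append {a b d : ℕ} {p q : List Edge} (h : G.Walk a b p) (h' : G.Walk b d q) :
    G.Walk a d (p ++ q) := by
  induction h with
  | nil => exact h'
  | cons e b p he _ ih => exact .cons e _ _ he (ih h')

theorem WF.walk_edge (hG : G.WF x) {e : Edge} (he : e ∈ G.edges) :
    G.Walk e.parent e.child [e] :=
  .cons e _ _ he (.nil _ (hG.lt e he).2.1)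

theorem Walk.eq_or_concat {a b : ℕ} {p : List Edge} (hG : G.WF x) (h : G.Walk a b p) :
    (p = [] ∧ a = b) ∨
      ∃ q, ∃ e ∈ G.edges, p = q ++ [e] ∧ e.child = b ∧ G.Walk a e.parent q := by
  induction h with
  | nil => exact .inl ⟨rfl, rfl⟩
  | cons e b p he _ ih =>
    right
    rcases ih with ⟨rfl, rfl⟩ | ⟨q, f, hf, rfl, rfl, hw⟩
    · exact ⟨[], e, he, rfl, rfl, .nil _ ((hG.lt e he).1.trans (hG.lt e he).2.1)⟩
    · exact ⟨e :: q, f, hf, rfl, rfl, .cons e _ _ he hw⟩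

theorem Walk.append_split {a b : ℕ} {p q : List Edge} (hG : G.WF x) (h : G.Walk a b (p ++ q)) :
    ∃ d, G.Walk a d p ∧ G.Walk d b q := by
  induction p generalizing a with
  | nil => exact ⟨a, .nil a ((h.le hG).1.trans_lt (h.le hG).2), h⟩
  | cons e p ih =>
    cases h with
    | cons _ _ _ he h =>
      obtain ⟨d, h1, h2⟩ := ih h
      exact ⟨d, .cons e _ _ he h1, h2⟩

theorem WF.exists_source_walk (hG : G.WF x) (a : ℕ) (ha : a < G.numNodes) :
    ∃ u p, G.IsSource u ∧ G.Walk u a p := by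
  induction a using Nat.strong_induction_on with
  | _ a ih =>
    rcases hG.source_or_child a ha with h | ⟨e, he, rfl⟩
    · exact ⟨a, [], h, .nil a ha⟩
    · have hlt := hG.lt e he
      obtain ⟨u, p, hu, hp⟩ := ih e.parent hlt.1 (hlt.1.trans hlt.2.1)
      exact ⟨u, _, hu, hp.append (hG.walk_edge he)⟩

theorem WF.exists_sink_walk (hG : G.WF x) (a : ℕ) (ha : a < G.numNodes) :
    ∃ v p, G.IsSink v ∧ G.Walk a v p := by
  induction hk : G.numNodes - a using Nat.strong_induction_on generalizing a with
  | _ k ih =>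
    rcases hG.sink_or_parent a ha with h | ⟨e, he, rfl⟩
    · exact ⟨a, [], h, .nil a ha⟩
    · have hlt := hG.lt e he
      obtain ⟨v, p, hv, hp⟩ := ih (G.numNodes - e.child) (by omega) e.child hlt.2.1 rfl
      exact ⟨v, _, hv, .cons e _ _ he hp⟩

/-- All move edges of the path move in the direction given by the sign of `s`. -/
def Directed (G : Graph) (s : ℝ) (p : List Edge) : Prop :=
  ∀ e ∈ p, e.kind = .move → 0 < s * (G.val e.child - G.val e.parent)

theorem directed_one {p : List Edge} : G.Directed 1 p ↔ G.Increasing p := by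
  simp [Directed, Increasing]

theorem directed_neg_one {p : List Edge} : G.Directed (-1) p ↔ G.Decreasing p := by
  simp [Directed, Decreasing]

theorem Walk.directed_le (hG : G.WF x) {s : ℝ} {a b : ℕ} {p : List Edge} (h : G.Walk a b p)
    (hp : G.Directed s p) : 0 ≤ s * (G.val b - G.val a) := by
  induction h with
  | nil => simp
  | cons e b p he _ ih =>
    have h1 := ih fun f hf => hp f (List.mem_cons_of_mem _ hf)
    have h2 : 0 ≤ s * (G.val e.child - G.val e.parent) := by
      by_cases hk : e.kind = .move
      · exact (hp e List.mem_cons_self hk).le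
      · simp [hG.val_eq e he hk]
    linarith

theorem Walk.val_eq (hG : G.WF x) {a b : ℕ} {p : List Edge} (h : G.Walk a b p)
    (hp : ∀ e ∈ p, e.kind ≠ .move) : G.val a = G.val b := by
  induction h with
  | nil => rfl
  | cons e b p he _ ih =>
    rw [hG.val_eq e he (hp e List.mem_cons_self), ih fun f hf => hp f (List.mem_cons_of_mem _ hf)]

end Graph

/-! ### The value of a merge node occurs at a source -/

theorem abs_sub_sign_mul {s w ε : ℝ} (hs : s = 1 ∨ s = -1) (hε : 0 ≤ ε) (h : ε ≤ s * w) :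
    |w - s * ε| = |w| - ε := by
  rcases hs with rfl | rfl
  · rw [abs_of_nonneg, abs_of_nonneg] <;> linarith
  · rw [abs_of_nonpos, abs_of_nonpos] <;> linarith

theorem abs_sign_mul {s ε : ℝ} (hs : s = 1 ∨ s = -1) (hε : 0 ≤ ε) : |s * ε| = ε := by
  rcases hs with rfl | rfl <;> simp [abs_of_nonneg hε]

open Classical in
/-- If all paths from sources to a node `δ` below merge edges go in the same direction, then one
of these sources has the value of `δ`; otherwise, stopping all moves above `δ` a bit earlier and
moving on only after the merges would be cheaper. -/
theorem exists_source_val_eq {c : ℝ} {x y : List ℝ} {S : List Op} (hopt : IsOptimal c x y S)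
    (hms : ∀ e ∈ (graph x S).edges, ∀ f ∈ (graph x S).edges, e.child = f.parent →
      ¬ (e.kind = .split ∧ f.kind = .merge)) {e₀ : Edge} (he₀ : e₀ ∈ (graph x S).edges)
    (hk₀ : e₀.kind = .merge) {s : ℝ} (hs : s = 1 ∨ s = -1)
    (hdir : ∀ u p, (graph x S).IsSource u → (graph x S).Walk u e₀.child p →
      (graph x S).Directed s p) :
    ∃ u ∈ (graph x S).subtreeSources e₀.child, (graph x S).val u = (graph x S).val e₀.child := by
  by_contra! hno
  obtain ⟨hG, hy⟩ := graph_wf hopt.1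
  generalize hGdef : graph x S = G at *
  generalize hδ : e₀.child = δ at *
  obtain ⟨ε, hε, hgap⟩ :=
    exists_pos_le_of_pos (fun e : Edge => s * (G.val e.child - G.val e.parent)) G.edges
  -- The nodes to be shifted by `-s * ε`. `δ` is left out: its value must be restored, since
  -- everything below it stays unchanged.
  let M : ℕ → Prop := fun a => a ≠ δ ∧ ∃ p, G.Walk a δ p ∧ ∀ e ∈ p, e.kind = .merge
  have hMout : ∀ a, M a → ∃ e ∈ G.edges, e.kind = .merge ∧ e.parent = a ∧
      (e.child = δ ∨ M e.child) := by
    rintro a ⟨ha, p, hp, hpk⟩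
    cases hp with
    | nil => exact absurd rfl ha
    | cons e _ p he hp =>
      refine ⟨e, he, hpk e List.mem_cons_self, rfl, or_iff_not_imp_left.2 fun h => ⟨h, p, hp, ?_⟩⟩
      exact fun f hf => hpk f (List.mem_cons_of_mem _ hf)
  have hMin : ∀ e ∈ G.edges, e.kind = .merge → e.child = δ ∨ M e.child → M e.parent := by
    intro e he hk h
    have hw : ∃ p, G.Walk e.child δ p ∧ ∀ e ∈ p, e.kind = .merge := by
      rcases h with h | h
      · exact ⟨[], h ▸ .nil _ (hG.lt e he).2.1, by simp⟩
      · exact h.2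
    obtain ⟨p, hp, hpk⟩ := hw
    refine ⟨((hG.lt e he).1.trans_le (hp.le hG).1).ne, e :: p, .cons e _ _ he hp, ?_⟩
    simpa [hk] using hpk
  have hMval : ∀ a, M a → G.val a = G.val δ := by
    rintro a ⟨-, p, hp, hpk⟩
    exact hp.val_eq hG fun e he => by simp [hpk e he]
  have hMsource : ∀ a, M a → ¬ G.IsSource a := fun a ha hsrc =>
    hno a ⟨hsrc, ha.2.imp fun _ h => h.1⟩ (hMval a ha)
  have hMmove : ∀ e ∈ G.edges, e.kind = .move → M e.child →
      ε ≤ s * (G.val e.child - G.val e.parent) := by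
    rintro e he hk ⟨-, p, hp, -⟩
    have hlt := hG.lt e he
    obtain ⟨u, q, hu, hq⟩ := hG.exists_source_walk e.parent (hlt.1.trans hlt.2.1)
    exact hgap e he (hdir u _ hu (hq.append (.cons e _ _ he hp)) e (by simp) hk)
  have hδin : ∀ e ∈ G.edges, e.child = δ → e.kind = .merge := fun e he h =>
    (hG.same_child e he e₀ he₀ (h.trans hδ.symm)).1.trans hk₀
  have hMpar : ∀ e ∈ G.edges, M e.parent → e.kind = .merge ∧ (e.child = δ ∨ M e.child) := by
    intro e he h
    obtain ⟨f, hf, hfk, hfp, hfc⟩ := hMout _ h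
    have h1 := hG.same_parent f hf e he hfp
    exact ⟨h1.1 ▸ hfk, h1.2 hfk ▸ hfc⟩
  have hMsplit : ∀ e ∈ G.edges, e.kind = .split → ¬ M e.child := by
    intro e he hk h
    obtain ⟨f, hf, hfk, hfp, -⟩ := hMout _ h
    exact hms e he f hf hfp.symm ⟨hk, hfk⟩
  let ψ : ℕ → ℝ := fun a => if M a then ε else 0
  have hψ1 : ∀ a, M a → ψ a = ε := fun a h => if_pos h
  have hψ0 : ∀ a, ¬ M a → ψ a = 0 := fun a h => if_neg h
  have hψnn : ∀ a, 0 ≤ ψ a := fun a => by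
    by_cases h : M a
    · rw [hψ1 a h]; exact hε.le
    · rw [hψ0 a h]
  -- A shifted node in the current row stands for a saving of `ε` already made, so it counts `-ε`.
  -- Once `δ` exists, one saving of `ε` is kept as final profit.
  let Φ : Graph → ℝ := fun H => -(H.sinks.map ψ).sum - if δ < H.numNodes then ε else 0
  have hδlt : δ < G.numNodes := hδ ▸ (hG.lt e₀ he₀).2.1
  obtain ⟨S', hS', hc⟩ := exists_shifted_transform (c := c) hopt.1 (fun a => -(s * ψ a)) Φ
    (fun i hi => by
      have : ψ i = 0 := hψ0 i fun h => hMsource i h (by rw [Graph.IsSource, hG.numSources]; exact hi)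
      simp [this])
    (by
      rw [hGdef]
      intro H o H' hH hst hsub hval
      have hval' : ∀ a ∈ H.sinks, H.val a = G.val a := fun a ha => by
        rw [← hst.val_eq a (hH.sinks_lt a ha),
          hval a ((hH.sinks_lt a ha).trans hst.numNodes_lt)]
      cases hst with
      | move l a r w hl =>
        simp only [List.cons_subset] at hsub
        have hn := hval H.numNodes (by simp)
        have hne : H.numNodes ≠ δ := fun h => by simpa using hδin _ hsub.1 h
        have ha : ψ a = 0 := hψ0 a fun h => by simpa using (hMpar _ hsub.1 h).1
        simp only [Function.update_self, hval' a (by simp [hl])] at hn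
        have hcost : |w - s * ψ H.numNodes| ≤ |w| - ψ H.numNodes := by
          by_cases h : M H.numNodes
          · have := hMmove _ hsub.1 rfl h
            simp only [← hn] at this
            rw [hψ1 _ h, abs_sub_sign_mul hs hε.le (by linarith)]
          · simp [hψ0 _ h]
        refine ⟨[.move l.length (w - s * ψ H.numNodes)], ?_, ?_⟩
        · rw [hl]
          exact transform_move l r (by rw [← hn, ha]; ring)
        · have : (δ < H.numNodes + 1) = (δ < H.numNodes) := by
            rw [eq_iff_iff]; omega
          simp only [Φ, hl, this, ha, cost, Op.cost, List.map_append, List.map_cons,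
            List.sum_append, List.sum_cons, List.map_nil, List.sum_nil]
          linarith
      | split l a r hl =>
        simp only [List.cons_subset] at hsub
        have hn := hval H.numNodes (by simp)
        have hm := hval (H.numNodes + 1) (by simp)
        have hne : H.numNodes ≠ δ := fun h => by simpa using hδin _ hsub.1 h
        have hme : H.numNodes + 1 ≠ δ := fun h => by simpa using hδin _ hsub.2.1 h
        have ha : ψ a = 0 := hψ0 a fun h => by simpa using (hMpar _ hsub.1 h).1
        have hn0 : ψ H.numNodes = 0 := hψ0 _ (hMsplit _ hsub.1 rfl)
        have hm0 : ψ (H.numNodes + 1) = 0 := hψ0 _ (hMsplit _ hsub.2.1 rfl)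
        simp [hval' a (by simp [hl])] at hn hm
        refine ⟨[.split l.length], ?_, ?_⟩
        · rw [hl]
          exact transform_split l r (by rw [← hn, ha, hn0]) (by rw [← hm, ha, hm0])
        · have : (δ < H.numNodes + 2) = (δ < H.numNodes) := by
            rw [eq_iff_iff]; omega
          simp only [Φ, hl, this, ha, hn0, hm0, cost, Op.cost, List.map_append, List.map_cons,
            List.sum_append, List.sum_cons, List.map_nil, List.sum_nil]
          linarith
      | merge l a b r hl hab =>
        simp only [List.cons_subset] at hsub
        have hn := hval H.numNodes (by simp)
        rw [hval' a (by simp [hl]), hval' b (by simp [hl])] at hab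
        simp only [Function.update_self, hval' a (by simp [hl])] at hn
        -- At `δ` two shifted nodes disappear, so `Φ` rises by `2 * ε - ε = ε`, exactly the price of
        -- the additional move.
        by_cases hnδ : H.numNodes = δ
        · have ha : ψ a = ε := hψ1 _ (hMin _ hsub.1 rfl (.inl hnδ))
          have hb : ψ b = ε := hψ1 _ (hMin _ hsub.2.1 rfl (.inl hnδ))
          have hn0 : ψ H.numNodes = 0 := hψ0 _ fun h => h.1 hnδ
          refine ⟨[.merge l.length, .move l.length (s * ε)], ?_, ?_⟩
          · rw [hl]
            exact transform_merge_move l r (by rw [hab, ha, hb]) (by rw [← hn, ha, hn0]; ring)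
          · have h1 : δ < H.numNodes + 1 := by omega
            have h2 : ¬ δ < H.numNodes := by omega
            simp only [Φ, hl, h1, h2, ha, hb, hn0, cost, Op.cost, List.map_append, List.map_cons,
              List.sum_append, List.sum_cons, List.map_nil, List.sum_nil, if_true, if_false,
              abs_sign_mul hs hε.le]
            linarith
        -- At any other merge both parents and the child are shifted, or none of them is. In the
        -- first case `Φ` rises by `ε` at no cost.
        · have ha : ψ a = ψ H.numNodes ∧ ψ b = ψ H.numNodes := by
            by_cases h : M H.numNodes
            · rw [hψ1 _ h, hψ1 a (hMin _ hsub.1 rfl (.inr h)),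
                hψ1 b (hMin _ hsub.2.1 rfl (.inr h))]
              simp
            · rw [hψ0 _ h, hψ0 a fun ha => ?_, hψ0 b fun hb => ?_]
              · simp
              · exact (hMpar _ hsub.2.1 hb).2.elim hnδ h
              · exact (hMpar _ hsub.1 ha).2.elim hnδ h
          refine ⟨[.merge l.length], ?_, ?_⟩
          · rw [hl]
            exact transform_merge l r (by rw [hab, ha.1, ha.2]) (by rw [← hn, ha.1])
          · have : (δ < H.numNodes + 1) = (δ < H.numNodes) := by
              rw [eq_iff_iff]; omega
            have := hψnn H.numNodes
            simp only [Φ, *, cost, Op.cost, List.map_append, List.map_cons,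
              List.sum_append, List.sum_cons, List.map_nil, List.sum_nil]
            linarith)
  rw [hGdef] at hS' hc
  have hfin : (G.sinks.map fun a => G.val a + -(s * ψ a)) = y := by
    rw [← hy]
    refine List.map_congr_left fun a ha => ?_
    have : ψ a = 0 := hψ0 a fun h => by
      obtain ⟨e, he, -, rfl, -⟩ := hMout a h
      exact hG.parent_not_sink e he ha
    simp [this]
  rw [hfin] at hS'
  have h1 : 0 ≤ (G.sinks.map ψ).sum := List.sum_nonneg (by simpa using fun a _ => hψnn a)
  have h2 : Φ (Graph.init x) = 0 := by
    have h3 : ¬ δ < x.length := by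
      have := (hG.lt e₀ he₀).2.2
      rw [hG.numSources, hδ] at this
      omega
    have h4 : ((List.range x.length).map ψ).sum = 0 := by
      refine List.sum_eq_zero ?_
      simp only [List.mem_map, List.mem_range, forall_exists_index, and_imp,
        forall_apply_eq_imp_iff₂]
      exact fun i hi => hψ0 i fun h => hMsource i h (by rw [Graph.IsSource, hG.numSources]; exact hi)
    simp [Φ, Graph.init, h3, h4]
  -- `Φ` starts at `0` and ends at most at `-ε`, so `S'` is cheaper than `S` by at least `ε`.
  have h5 := hopt.2 S' hS'
  simp only [h2, Φ, hδlt, if_true] at hc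
  linarith

end MSM

namespace MSM

/-! ### The value of the second bottleneck node occurs at a sink -/

open Classical in
/-- If all paths from a node `σ` below a move edge to sinks go in the direction of this edge and
`σ` is split, then one of these sinks has the value of `σ`; otherwise, moving a bit further before
the splits, which shortens all moves below them, would be cheaper. -/
theorem exists_sink_val_eq {c : ℝ} {x y : List ℝ} {S : List Op} (hopt : IsOptimal c x y S)
    (hsm : ∀ e ∈ (graph x S).edges, ∀ f ∈ (graph x S).edges, e.child = f.parent →
      ¬ (e.kind = .split ∧ f.kind = .merge)) {e₀ f₀ : Edge} (he₀ : e₀ ∈ (graph x S).edges)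
    (hk₀ : e₀.kind = .move) (hf₀ : f₀ ∈ (graph x S).edges) (hfk₀ : f₀.kind = .split)
    (hef : e₀.child = f₀.parent) {s : ℝ} (hs : s = 1 ∨ s = -1)
    (hdir : ∀ v p, (graph x S).IsSink v → (graph x S).Walk e₀.child v p →
      (graph x S).Directed s p) :
    ∃ v p, (graph x S).IsSink v ∧ (graph x S).Walk e₀.child v p ∧
      (graph x S).val v = (graph x S).val e₀.child := by
  by_contra! hno
  obtain ⟨hG, hy⟩ := graph_wf hopt.1
  generalize hGdef : graph x S = G at *
  generalize hσ : e₀.child = σ at *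
  obtain ⟨ε, hε, hgap⟩ :=
    exists_pos_le_of_pos (fun e : Edge => s * (G.val e.child - G.val e.parent)) G.edges
  -- The nodes to be shifted by `s * ε`. This time `σ` itself belongs to them, as the move into it
  -- is prolonged.
  let M : ℕ → Prop := fun a => ∃ p, G.Walk σ a p ∧ ∀ e ∈ p, e.kind = .split
  have hMin : ∀ e ∈ G.edges, M e.child → e.child = σ ∨ (e.kind = .split ∧ M e.parent) := by
    rintro e he ⟨p, hp, hpk⟩
    rcases hp.eq_or_concat hG with ⟨-, h⟩ | ⟨q, f, hf, rfl, hfc, hq⟩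
    · exact .inl h.symm
    · have hfk := hpk f (by simp)
      have h1 := hG.same_child f hf e he hfc
      rw [hfk] at h1
      refine .inr ⟨h1.1.symm, ?_⟩
      rw [← h1.2 (by simp)]
      exact ⟨q, hq, fun g hg => hpk g (by simp [hg])⟩
  have hMout : ∀ e ∈ G.edges, e.kind = .split → M e.parent → M e.child := by
    rintro e he hk ⟨p, hp, hpk⟩
    refine ⟨p ++ [e], hp.append (hG.walk_edge he), fun g hg => ?_⟩
    rcases List.mem_append.1 hg with hg | hg
    · exact hpk g hg
    · rw [List.mem_singleton.1 hg, hk]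
  have hσnot : ∀ a < σ, ¬ M a := fun a ha ⟨p, hp, _⟩ => absurd (hp.le hG).1 (by omega)
  have hσlt := hG.lt e₀ he₀
  rw [hσ] at hσlt
  have hMσ : M σ := ⟨[], .nil _ hσlt.2.1, by simp⟩
  have hσin : ∀ e ∈ G.edges, e.child = σ → e.kind = .move ∧ ¬ M e.parent := fun e he h =>
    ⟨(hG.same_child e he e₀ he₀ (h.trans hσ.symm)).1.trans hk₀,
      hσnot _ ((hG.lt e he).1.trans_eq h)⟩
  have hMval : ∀ a, M a → G.val a = G.val σ := by
    rintro a ⟨p, hp, hpk⟩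
    exact (hp.val_eq hG fun e he => by simp [hpk e he]).symm
  have hMsink : ∀ a, M a → ¬ G.IsSink a := fun a ha h => by
    have ⟨p, hp, _⟩ := ha
    exact hno a p h hp (hMval a ha)
  have hMsource : ∀ a, M a → ¬ a < x.length := by
    rintro a ⟨p, hp, -⟩ h
    rw [← hG.numSources] at h
    have := (hp.le hG).1
    omega
  -- At `σ` a merge is impossible because its outgoing edges have the kind of `f₀`; further down it
  -- would follow a split.
  have hMmerge : ∀ e ∈ G.edges, e.kind = .merge → ¬ M e.parent := by
    rintro e he hk ⟨p, hp, hpk⟩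
    rcases hp.eq_or_concat hG with ⟨-, h⟩ | ⟨q, f, hf, rfl, hfc, hq⟩
    · have := (hG.same_parent e he f₀ hf₀ (h.symm.trans hef)).1
      rw [hk, hfk₀] at this
      simp at this
    · exact hsm f hf e he hfc ⟨hpk f (by simp), hk⟩
  have hMmove : ∀ e ∈ G.edges, e.kind = .move → M e.parent →
      ε ≤ s * (G.val e.child - G.val e.parent) := by
    rintro e he hk ⟨p, hp, -⟩
    obtain ⟨v, q, hv, hq⟩ := hG.exists_sink_walk e.child (hG.lt e he).2.1
    exact hgap e he (hdir v _ hv (hp.append (.cons e _ _ he hq)) e (by simp) hk)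
  let ψ : ℕ → ℝ := fun a => if M a then ε else 0
  have hψ1 : ∀ a, M a → ψ a = ε := fun a h => if_pos h
  have hψ0 : ∀ a, ¬ M a → ψ a = 0 := fun a h => if_neg h
  let I : Graph → Prop := fun H => ∃ e ∈ H.edges, e.kind = .split ∧ e.parent = σ
  -- Each shifted node in the row is a debt of `ε` to be repaid by a shorter move. The first split
  -- of `σ` doubles the debt without cost; the indicator `I` books this gain as profit.
  let Φ : Graph → ℝ := fun H => (H.sinks.map ψ).sum - if I H then ε else 0
  obtain ⟨S', hS', hc⟩ := exists_shifted_transform (c := c) hopt.1 (fun a => s * ψ a) Φ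
    (fun i hi => by simp [hψ0 i fun h => hMsource i h hi])
    (by
      rw [hGdef]
      intro H o H' hH hst hsub hval
      have hval' : ∀ a ∈ H.sinks, H.val a = G.val a := fun a ha => by
        rw [← hst.val_eq a (hH.sinks_lt a ha),
          hval a ((hH.sinks_lt a ha).trans hst.numNodes_lt)]
      cases hst with
      | move l a r w hl =>
        simp only [List.cons_subset] at hsub
        have hn := hval H.numNodes (by simp)
        simp only [Function.update_self, hval' a (by simp [hl])] at hn
        -- A move enters `M` only at `σ`, which costs at most `ε` more; a move that leaves `M` saves
        -- exactly `ε`.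
        have hcost : |w + s * ψ H.numNodes - s * ψ a| ≤ |w| + ψ H.numNodes - ψ a := by
          by_cases h : M H.numNodes
          · have ha : ¬ M a := by
              rcases hMin _ hsub.1 h with h1 | h1
              · exact (hσin _ hsub.1 h1).2
              · simp at h1
            rw [hψ1 _ h, hψ0 _ ha]
            have := abs_add_le w (s * ε)
            rw [abs_sign_mul hs hε.le] at this
            simpa using this
          · by_cases ha : M a
            · have := hMmove _ hsub.1 rfl ha
              simp only [← hn] at this
              rw [hψ0 _ h, hψ1 _ ha, mul_zero, add_zero, add_zero,
                abs_sub_sign_mul hs hε.le (by linarith)]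
            · simp [hψ0 _ h, hψ0 _ ha]
        refine ⟨[.move l.length (w + s * ψ H.numNodes - s * ψ a)], ?_, ?_⟩
        · rw [hl]
          exact transform_move l r (by rw [← hn]; ring)
        · simp only [Φ, I, hl, cost, Op.cost, List.map_append, List.map_cons, List.mem_cons,
            List.sum_append, List.sum_cons, List.map_nil, List.sum_nil, exists_eq_or_imp,
            reduceCtorEq, false_and, false_or]
          linarith
      | split l a r hl =>
        simp only [List.cons_subset] at hsub
        have hn := hval H.numNodes (by simp)
        have hm := hval (H.numNodes + 1) (by simp)
        have hiff : ∀ e ∈ G.edges, e.kind = .split → e.parent = a → ψ e.child = ψ a := by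
          rintro e he hk rfl
          by_cases ha : M e.parent
          · rw [hψ1 _ ha, hψ1 _ (hMout e he hk ha)]
          · rw [hψ0 _ ha, hψ0 _ fun h => ?_]
            rcases hMin e he h with h1 | h1
            · have := (hσin e he h1).1
              rw [hk] at this
              simp at this
            · exact ha h1.2
        have hna := hiff _ hsub.1 rfl rfl
        have hma := hiff _ hsub.2.1 rfl rfl
        simp [hval' a (by simp [hl])] at hn hm
        refine ⟨[.split l.length], ?_, ?_⟩
        · rw [hl]
          exact transform_split l r (by rw [← hn, hna]) (by rw [← hm, hma])
        · have hΦ : (if I { H with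
              numNodes := H.numNodes + 2
              val := Function.update (Function.update H.val H.numNodes (H.val a))
                (H.numNodes + 1) (H.val a)
              edges := ⟨.split, a, H.numNodes⟩ :: ⟨.split, a, H.numNodes + 1⟩ :: H.edges
              sinks := l ++ H.numNodes :: (H.numNodes + 1) :: r } then ε else 0) ≤
              (if I H then ε else 0) + ψ a := by
            by_cases ha : M a
            · rw [hψ1 a ha]
              split_ifs <;> linarith
            · have hne : a ≠ σ := by rintro rfl; exact ha hMσ
              simp [I, hne, hψ0 a ha]
          simp only [Φ, hl, cost, Op.cost, List.map_append, List.map_cons,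
            List.sum_append, List.sum_cons, List.map_nil, List.sum_nil] at hna hma ⊢
          linarith
      | merge l a b r hl hab =>
        simp only [List.cons_subset] at hsub
        have hn := hval H.numNodes (by simp)
        rw [hval' a (by simp [hl]), hval' b (by simp [hl])] at hab
        simp only [Function.update_self, hval' a (by simp [hl])] at hn
        have ha : ψ a = 0 := hψ0 _ (hMmerge _ hsub.1 rfl)
        have hb : ψ b = 0 := hψ0 _ (hMmerge _ hsub.2.1 rfl)
        have hn0 : ψ H.numNodes = 0 := hψ0 _ fun h => by
          rcases hMin _ hsub.1 h with h1 | h1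
          · simpa using (hσin _ hsub.1 h1).1
          · simp at h1
        refine ⟨[.merge l.length], ?_, ?_⟩
        · rw [hl]
          exact transform_merge l r (by rw [hab, ha, hb]) (by rw [← hn, ha, hn0])
        · simp only [Φ, I, hl, cost, Op.cost, List.map_append, List.map_cons, List.mem_cons,
            List.sum_append, List.sum_cons, List.map_nil, List.sum_nil, exists_eq_or_imp,
            reduceCtorEq, false_and, false_or, ha, hb, hn0]
          linarith)
  rw [hGdef] at hS' hc
  have hsink0 : ∀ a ∈ G.sinks, ψ a = 0 := fun a ha => hψ0 a fun h => hMsink a h ha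
  have hfin : (G.sinks.map fun a => G.val a + s * ψ a) = y := by
    rw [← hy]
    exact List.map_congr_left fun a ha => by simp [hsink0 a ha]
  rw [hfin] at hS'
  have h1 : (G.sinks.map ψ).sum = 0 := List.sum_eq_zero (by simpa using hsink0)
  have h2 : Φ (Graph.init x) = 0 := by
    have h3 : ((List.range x.length).map ψ).sum = 0 := by
      refine List.sum_eq_zero ?_
      simp only [List.mem_map, List.mem_range, forall_exists_index, and_imp,
        forall_apply_eq_imp_iff₂]
      exact fun i hi => hψ0 i fun h => hMsource i h hi
    simp [Φ, I, Graph.init, h3]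
  have h3 : I G := ⟨f₀, hf₀, hfk₀, hef.symm⟩
  -- No sink is shifted and `σ` has been split, so `Φ` runs from `0` to `-ε`.
  have h5 := hopt.2 S' hS'
  simp only [h2, Φ, h1, h3, if_true] at hc
  linarith

/-! ### Application to optimal transformation forests -/

theorem Graph.Walk.of_cons {G : Graph} {a b : ℕ} {e : Edge} {p : List Edge}
    (h : G.Walk a b (e :: p)) : e ∈ G.edges ∧ a = e.parent ∧ G.Walk e.child b p := by
  cases h with
  | cons _ _ _ he h => exact ⟨he, rfl, h⟩

theorem Graph.Walk.reachable {G : Graph} {x : List ℝ} (hG : G.WF x) {a b : ℕ} {p : List Edge}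
    (h : G.Walk a b p) : G.underlying.Reachable a b := by
  induction h with
  | nil => exact .rfl
  | cons e b p he _ ih =>
    refine SimpleGraph.Reachable.trans (SimpleGraph.Adj.reachable ?_) ih
    rw [Graph.underlying, SimpleGraph.fromRel_adj]
    exact ⟨(hG.lt e he).1.ne, .inl ⟨e, he, rfl, rfl⟩⟩

theorem Graph.IsTreeComponent.mem_of_reachable {G : Graph} {T : Set ℕ} (hT : G.IsTreeComponent T)
    {a b : ℕ} (ha : a ∈ T) (h : G.underlying.Reachable a b) : b ∈ T := by
  obtain ⟨⟨d, -, rfl⟩, -⟩ := hT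
  exact SimpleGraph.Reachable.trans ha h

/-- Both halves of (a) at once: `s = 1` gives the maximum, `s = -1` the minimum. -/
theorem IsOptimalForest.exists_source_val_eq {c : ℝ} {x y : List ℝ} {S : List Op}
    (hS : IsOptimalForest c x y S) {e : Edge} (he : e ∈ (graph x S).edges)
    (hk : e.kind = .merge) {s : ℝ} (hs : s = 1 ∨ s = -1)
    (hdir : ∀ u p, (graph x S).IsSource u → (graph x S).Walk u e.child p →
      (graph x S).Directed s p) :
    (graph x S).val e.child ∈
        (graph x S).sourceValues x ((graph x S).subtreeSources e.child) ∧
      ∀ r ∈ (graph x S).sourceValues x ((graph x S).subtreeSources e.child),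
        0 ≤ s * ((graph x S).val e.child - r) := by
  obtain ⟨hG, -⟩ := graph_wf hS.optimal.1
  have hsrc : ∀ u, (graph x S).IsSource u → x[u]? = some ((graph x S).val u) := fun u hu =>
    hG.source_val u (by rwa [← hG.numSources])
  constructor
  · obtain ⟨u, hu, huv⟩ := MSM.exists_source_val_eq hS.optimal
      (fun e he f hf h => (hS.no_merge_split e he f hf h).2) he hk hs hdir
    exact ⟨u, hu.1, hu, huv ▸ hsrc u hu.1⟩
  · rintro r ⟨i, hi, ⟨-, p, hp⟩, hr⟩
    rw [hsrc i hi, Option.some.injEq] at hr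
    exact hr ▸ hp.directed_le hG (hdir i p hi hp)

theorem IsOptimalForest.val_bottleneck {c : ℝ} {x y : List ℝ} {S : List Op}
    (hS : IsOptimalForest c x y S) {T : Set ℕ} {σ σ' : ℕ}
    (hT : (graph x S).IsTypeFourTree T σ σ') :
    (graph x S).val σ ∈ (graph x S).sourceValues x T ∧
      (graph x S).val σ' ∈ (graph x S).sinkValues y T := by
  obtain ⟨hG, hy⟩ := graph_wf hS.optimal.1
  obtain ⟨htree, hsrcs, -, hpaths, -, -⟩ := hT
  obtain ⟨u, huT, hu⟩ := hsrcs.nonempty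
  have hult : u < (graph x S).numNodes := lt_of_lt_of_le hu hG.le
  obtain ⟨v, p, hv, hp⟩ := hG.exists_sink_walk u hult
  obtain ⟨A, e, f, B, rfl, -, hek, -, hfk, -⟩ := hpaths u huT v p ⟨hu, hv, hp⟩
  obtain ⟨d, hA, hd⟩ := hp.append_split hG
  obtain ⟨he, rfl, hd₁⟩ := hd.of_cons
  obtain ⟨hb, heb, hd₂⟩ := hd₁.of_cons
  have hf := hd₂.of_cons
  simp only at heb hf hd₂
  -- Monotonic paths that share the bottleneck move share its direction, which is therefore the sign
  -- `s`.
  obtain ⟨s, hs, hbs⟩ : ∃ s : ℝ, (s = 1 ∨ s = -1) ∧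
      ∀ p w z, (graph x S).IsTransformationPath w z p → (⟨.move, σ, σ'⟩ : Edge) ∈ p →
        (graph x S).Directed s p := by
    have hdir : ∀ p w z, (graph x S).IsTransformationPath w z p →
        (graph x S).Directed 1 p ∨ (graph x S).Directed (-1) p := fun p w z h => by
      rw [Graph.directed_one, Graph.directed_neg_one]
      exact hS.monotonic w z p h
    rcases lt_or_ge ((graph x S).val σ) ((graph x S).val σ') with hlt | hge
    · refine ⟨1, .inl rfl, fun p w z h hmem => (hdir p w z h).resolve_right fun h' => ?_⟩
      have := h' _ hmem rfl
      simp only at this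
      linarith
    · refine ⟨-1, .inr rfl, fun p w z h hmem => (hdir p w z h).resolve_left fun h' => ?_⟩
      have := h' _ hmem rfl
      simp only at this
      linarith
  obtain ⟨u', q, hu', hq⟩ := hG.exists_source_walk σ
    ((hG.lt _ hb).1.trans (hG.lt _ hb).2.1)
  have hσT : σ ∈ T := by
    have hw := hA.append (heb ▸ hG.walk_edge he)
    exact htree.mem_of_reachable huT (hw.reachable hG)
  have hσσ' := hG.walk_edge hb
  constructor
  -- A walk from a source to `σ` extends through the bottleneck to the sink `v`, so monotonicity of
  -- transformation paths applies to it.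
  · obtain ⟨⟨i, hi, ⟨-, r, hr⟩, hix⟩, -⟩ := hS.exists_source_val_eq he hek hs fun w r hw hr => by
      rw [heb] at hr
      have := hbs _ w v ⟨hw, hv, hr.append (hσσ'.append hd₂)⟩ (by simp)
      exact fun g hg => this g (by simp [hg])
    rw [heb] at hr hix
    exact ⟨i, hi, htree.mem_of_reachable hσT (hr.reachable hG).symm, hix⟩
  -- Likewise a walk from `σ'` to a sink is completed upwards by the walk `q` from the source `u'`.
  · obtain ⟨z, r, hz, hr, hzv⟩ := exists_sink_val_eq hS.optimal
      (fun e he f hf h => (hS.no_merge_split e he f hf h).2) hb rfl hf.1 hfk hf.2.1 hs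
      fun z r hz hr => by
        have := hbs _ u' z ⟨hu', hz, hq.append (hσσ'.append hr)⟩ (by simp)
        exact fun g hg => this g (by simp [hg])
    obtain ⟨j, hj⟩ := List.mem_iff_getElem?.1 hz
    exact ⟨j, z, hj, htree.mem_of_reachable hσT ((hσσ'.append hr).reachable hG),
      by rw [← hy, List.getElem?_map, hj, Option.map_some, hzv]⟩

end MSM

theorem mainTheorem6 (c : ℝ) (hc : 0 ≤ c) (x y : List ℝ) (S : List MSM.Op)
    (hS : MSM.IsOptimalForest c x y S) :
    (∀ δ, (MSM.graph x S).IsMergeNode δ →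
      ((MSM.graph x S).IncreasingSubtree δ →
        IsGreatest ((MSM.graph x S).sourceValues x ((MSM.graph x S).subtreeSources δ))
          ((MSM.graph x S).val δ)) ∧
      ((MSM.graph x S).DecreasingSubtree δ →
        IsLeast ((MSM.graph x S).sourceValues x ((MSM.graph x S).subtreeSources δ))
          ((MSM.graph x S).val δ))) ∧
    (∀ (T : Set ℕ) (σ σ' : ℕ), (MSM.graph x S).IsTypeFourTree T σ σ' →
      (MSM.graph x S).val σ ∈ (MSM.graph x S).sourceValues x T ∧
      (MSM.graph x S).val σ' ∈ (MSM.graph x S).sinkValues y T) := by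
  refine ⟨?_, fun T σ σ' hT => hS.val_bottleneck hT⟩
  rintro δ ⟨-, α, -, -, he, -⟩
  constructor
  · intro h
    obtain ⟨h1, h2⟩ := hS.exists_source_val_eq he rfl (.inl rfl) fun u p hu hp =>
      MSM.Graph.directed_one.2 (h u p hu hp)
    exact ⟨h1, fun r hr => by linarith [h2 r hr]⟩
  · intro h
    obtain ⟨h1, h2⟩ := hS.exists_source_val_eq he rfl (.inr rfl) fun u p hu hp =>
      MSM.Graph.directed_neg_one.2 (h u p hu hp)
    exact ⟨h1, fun r hr => by linarith [h2 r hr]⟩
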